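/- **Setting.** Let $\mathcal N$ (nodes), $\mathcal F$ (tones) and a set of multicast sessions $m$ be finite, and let $\mathcal A$ be a finite set of hyperarcs $(i,J)$, $i\in\mathcal N$, $J\subseteq\mathcal N$. Put $\mathcal G=\{(i,j): j\in J \text{ for some } (i,J)\in\mathcal A\}$ and $N(i)=\{j:(i,j)\in\mathcal G\}$. Session $m$ has a source $s^m\in\mathcal N$ and a sink set $T^m\subseteq\mathcal N$. The channel $\mathbf h$ is a random vector in $\mathbb R_+^{d}$, $d\ge 1$, whose law is absolutely continuous with respect to Lebesgue measure. Let $\Pi$ be a bounded set of power vectors $(p_{iJ}^f)$; a *policy* is a measurable function $\mathbf p(\cdot)$ of $\mathbf h$ with $\mathbf p(\mathbf h)\in\Pi$ almost surely. Let $C_{iJ}^f(\mathbf p,\mathbf h)$ be real functions such that $\sum_f C_{iJ}^f(\mathbf p(\mathbf h),\mathbf h)$ is integrable for every policy. The vector $\mathbf y$ stacks real variables $a^m$, $z_{iJ}^m$, $x_{ij}^{mt}$ ($t\in T^m$, $(i,j)\in\mathcal G$), $c_{iJ}$ and $p_i$. Let $\mathcal B$ be the set of pairs $(\mathbf y,\mathbf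 p(\cdot))$ such that $\mathbf p(\cdot)$ is a policy and $a^m_{\min}\le a^m\le a^m_{\max}$, $0\le z_{iJ}^m\le z_{iJ}^{\max}$, $0\le x_{ij}^{mt}\le x_{ij}^{\max}$, $0\le c_{iJ}\le c_{iJ}^{\max}$, $0\le p_i\le p_i^{\max}$; the latter inequalities define the box $\mathcal B_{\mathbf y}$. Let $f(\mathbf y)=\sum_m U_m(a^m)-\sum_i V_i(p_i)$ with $U_m$ concave on $[a^m_{\min},a^m_{\max}]$ and $V_i$ convex on $[0,p_i^{\max}]$. Let $\mathbf q(\mathbf y,\mathbf p)=\mathbf g(\mathbf y)+\mathbf v(\mathbf p)$ be the vector of the left-hand sides of the constraints (written with zero right-hand side) $$\sigma_i^m-\sum_{j:(i,j)\in\mathcal G}x_{ij}^{mt}+\sum_{j:(j,i)\in\mathcal G}x_{ji}^{mt}\le 0\quad(t\in T^m,\ i\ne t),$$ $$\sum_{j\in K}x_{ij}^{mt}-\sum_{J:(i,J)\in\mathcal A,\,J\cap K\neq\emptyset}z_{iJ}^m\le 0\quad(t\in T^m,\ i\in\mathcal N,\ \emptyset\ne K\subseteq N(i)),$$ $$\sum_m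 z_{iJ}^m-c_{iJ}\le 0,\qquad c_{iJ}-\mathbb E\Big[\sum_f C_{iJ}^f(\mathbf p(\mathbf h),\mathbf h)\Big]\le 0\qquad((i,J)\in\mathcal A),$$ $$\mathbb E\Big[\sum_f\sum_{J:(i,J)\in\mathcal A}p_{iJ}^f(\mathbf h)\Big]-p_i\le 0\qquad(i\in\mathcal N),$$ where $\sigma_i^m=a^m$ if $i=s^m$ and $\sigma_i^m=0$ otherwise (for $i\neq t$); $\mathbf v(\mathbf p)$ consists of the expectation terms and $\mathbf g(\mathbf y)$ of all the others. Let $\mathsf P=\sup\{f(\mathbf y):(\mathbf y,\mathbf p)\in\mathcal B,\ \mathbf q(\mathbf y,\mathbf p)\le\mathbf 0\}$. Assume Slater's condition: some $(\mathbf y',\mathbf p')\in\mathcal B$ satisfies all the constraints strictly. Let $G,\bar G$ be such that $\|\mathbf q(\mathbf y,\mathbf p)\|\le G$ for all $(\mathbf y,\mathbf p)\in\mathcal B$ and $\|\mathbf v(\mathbf p)\|\le\bar G$ for all policies $\mathbf p$ (Euclidean norms). **Asynchronous method.** Fix $\epsilon>0$, $D\in\mathbb N$ and times $\tau(\ell)$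 with $1\le\tau(\ell)\le\ell$ and $\ell-\tau(\ell)\le D$ for all $\ell\ge1$. Let $\boldsymbol\zeta(1)\ge\mathbf 0$ be arbitrary and, for $\ell\ge 1$, $$\mathbf y(\ell)\in\arg\max_{\mathbf y\in\mathcal B_{\mathbf y}}\{f(\mathbf y)-\boldsymbol\zeta(\ell)^T\mathbf g(\mathbf y)\},\qquad \mathbf p(\cdot;\tau(\ell))\in\arg\max_{\mathbf p\text{ a policy}}\{-\boldsymbol\zeta(\tau(\ell))^T\mathbf v(\mathbf p)\},$$ $$\boldsymbol\zeta(\ell+1)=\big[\boldsymbol\zeta(\ell)+\epsilon\big(\mathbf g(\mathbf y(\ell))+\mathbf v(\mathbf p(\cdot;\tau(\ell)))\big)\big]^+,$$ where $[\cdot]^+$ is the projection onto the nonnegative orthant. Put $\bar{\mathbf y}(s)=\frac1s\sum_{\ell=1}^s\mathbf y(\ell)$. **Proposition 5.** a) There exist policies $\mathring{\mathbf p}(\cdot;s)$, $s\ge 1$, such that $(\bar{\mathbf y}(s),\mathring{\mathbf p}(\cdot;s))\in\mathcal B$ for all $s\ge1$ and $\lim_{s\to\infty}\big\|[\mathbf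 q(\bar{\mathbf y}(s),\mathring{\mathbf p}(\cdot;s))]^+\big\|=0$. b) $\displaystyle\liminf_{s\to\infty}f(\bar{\mathbf y}(s))\ge\mathsf P-\frac{\epsilon G^2}{2}-2\epsilon D\bar G G$ and $\displaystyle\limsup_{s\to\infty}f(\bar{\mathbf y}(s))\le\mathsf P$. -/

import Mathlib

open MeasureTheory Filter Topology

noncomputable section

/-- The data of the cross-layer design problem for a coded wireless fading network with nodes `N`,
tones `F`, multicast sessions `M` and (stacked) channel gains indexed by `κ`.
A hyperarc `(i, J)` is a broadcast link from the node `i` to the set of nodes `J`. -/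
structure CodedNetwork (N F M κ : Type*) where
  /-- the set of hyperarcs -/
  hyperarcs : Finset (N × Finset N)
  /-- the source node of each session -/
  source : M → N
  /-- the sink nodes of each session -/
  sinks : M → Finset N
  /-- the distribution of the channel vector -/
  channelLaw : Measure (κ → ℝ)
  /-- the set `Π` of admissible instantaneous power allocations `(p_{iJ}^f)` -/
  powerSet : Set ({e // e ∈ hyperarcs} → F → ℝ)
  /-- the instantaneous capacity `C_{iJ}^f(p, h)` -/
  capacity : {e // e ∈ hyperarcs} → F → ({e // e ∈ hyperarcs} → F → ℝ) → (κ → ℝ) → ℝ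
  /-- the utility `U_m` of each session -/
  utility : M → ℝ → ℝ
  /-- the power cost `V_i` of each node -/
  cost : N → ℝ → ℝ
  /-- box constraints: bounds on `a^m`, `z_{iJ}^m`, `x_{ij}^{mt}`, `c_{iJ}`, `p_i` -/
  rateMin : M → ℝ
  rateMax : M → ℝ
  flowMax : {e // e ∈ hyperarcs} → ℝ
  virtualMax : N → N → ℝ
  linkMax : {e // e ∈ hyperarcs} → ℝ
  powerMax : N → ℝ

namespace CodedNetwork

variable {N F M κ : Type*} [Fintype N] [DecidableEq N] [Fintype F] [Fintype M]

/-- Hyperarcs, as a type. -/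
abbrev Arc (𝒩 : CodedNetwork N F M κ) : Type _ := {e // e ∈ 𝒩.hyperarcs}

/-- The neighbouring pairs `(i, j)`, i.e. those with `j ∈ J` for some hyperarc `(i, J)`. -/
abbrev Edge (𝒩 : CodedNetwork N F M κ) : Type _ :=
  {ij : N × N // ∃ J, (ij.1, J) ∈ 𝒩.hyperarcs ∧ ij.2 ∈ J}

/-- The pairs `(m, t)` of a session and one of its sinks. -/
abbrev Sink (𝒩 : CodedNetwork N F M κ) : Type _ := {mt : M × N // mt.2 ∈ 𝒩.sinks mt.1}

/-- The set of nodes that the node `i` reaches. -/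
def neighbors (𝒩 : CodedNetwork N F M κ) (i : N) : Finset N :=
  Finset.univ.filter fun j => ∃ J, (i, J) ∈ 𝒩.hyperarcs ∧ j ∈ J

/-- Vectors `y` that stack `a^m`, `z_{iJ}^m`, `x_{ij}^{mt}`, `c_{iJ}` and `p_i`. -/
abbrev Primal (𝒩 : CodedNetwork N F M κ) : Type _ :=
  M ⊕ (𝒩.Arc × M) ⊕ (𝒩.Sink × 𝒩.Edge) ⊕ 𝒩.Arc ⊕ N → ℝ

namespace Primal

variable {𝒩 : CodedNetwork N F M κ}

/-- The session rate `a^m`. -/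
def a (y : 𝒩.Primal) (m : M) : ℝ := y (.inl m)

/-- The broadcast link flow `z_{iJ}^m`. -/
def z (y : 𝒩.Primal) (e : 𝒩.Arc) (m : M) : ℝ := y (.inr (.inl (e, m)))

/-- The virtual flow `x_{ij}^{mt}`. -/
def x (y : 𝒩.Primal) (mt : 𝒩.Sink) (ij : 𝒩.Edge) : ℝ := y (.inr (.inr (.inl (mt, ij))))

/-- The link capacity `c_{iJ}`. -/
def c (y : 𝒩.Primal) (e : 𝒩.Arc) : ℝ := y (.inr (.inr (.inr (.inl e))))

/-- The average power `p_i`. -/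
def pow (y : 𝒩.Primal) (i : N) : ℝ := y (.inr (.inr (.inr (.inr i))))

end Primal

/-- Power allocation policies `h ↦ p(h)`. -/
abbrev Policy (𝒩 : CodedNetwork N F M κ) : Type _ := (κ → ℝ) → 𝒩.Arc → F → ℝ

/-- The index set of the flow conservation constraints: `(m, t)` and `i ≠ t`. -/
abbrev FlowCon (𝒩 : CodedNetwork N F M κ) : Type _ := {c : 𝒩.Sink × N // c.2 ≠ c.1.1.2}

/-- The index set of the broadcast constraints: `(m, t)`, `i` and `∅ ≠ K ⊆ N(i)`. -/
abbrev UnionCon (𝒩 : CodedNetwork N F M κ) : Type _ :=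
  {c : 𝒩.Sink × N × Finset N // c.2.2.Nonempty ∧ c.2.2 ⊆ 𝒩.neighbors c.2.1}

/-- The index set of all constraints: flow conservation, broadcast, link rate, capacity, power. -/
abbrev Con (𝒩 : CodedNetwork N F M κ) : Type _ :=
  𝒩.FlowCon ⊕ 𝒩.UnionCon ⊕ 𝒩.Arc ⊕ 𝒩.Arc ⊕ N

/-- Vectors indexed by the constraints (constraint values, Lagrange multipliers), with the
Euclidean norm. -/
abbrev Mult (𝒩 : CodedNetwork N F M κ) : Type _ := EuclideanSpace ℝ 𝒩.Con

/-- The net rate `σ_i^m` that the node `i` injects, for session `m` with rate `r` and sink `t`. -/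
def injection (𝒩 : CodedNetwork N F M κ) (m : M) (t : N) (r : ℝ) (i : N) : ℝ :=
  if i = t then -r else if i = 𝒩.source m then r else 0

/-- The box of the finite-dimensional variables. -/
def box (𝒩 : CodedNetwork N F M κ) : Set 𝒩.Primal :=
  {y | (∀ m, 𝒩.rateMin m ≤ y.a m ∧ y.a m ≤ 𝒩.rateMax m) ∧
    (∀ e m, 0 ≤ y.z e m ∧ y.z e m ≤ 𝒩.flowMax e) ∧
    (∀ mt ij, 0 ≤ y.x mt ij ∧ y.x mt ij ≤ 𝒩.virtualMax ij.1.1 ij.1.2) ∧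
    (∀ e, 0 ≤ y.c e ∧ y.c e ≤ 𝒩.linkMax e) ∧
    (∀ i, 0 ≤ y.pow i ∧ y.pow i ≤ 𝒩.powerMax i)}

/-- The measurable power policies with values in `Π` for almost all channels. -/
def policies (𝒩 : CodedNetwork N F M κ) : Set 𝒩.Policy :=
  {p | Measurable p ∧ ∀ᵐ h ∂𝒩.channelLaw, p h ∈ 𝒩.powerSet}

/-- The constraint set `𝓑` of pairs `(y, p)`. -/
def constraintSet (𝒩 : CodedNetwork N F M κ) : Set (𝒩.Primal × 𝒩.Policy) :=
  {yp | yp.1 ∈ 𝒩.box ∧ yp.2 ∈ 𝒩.policies}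

/-- The objective `f(y) = ∑ U_m(a^m) - ∑ V_i(p_i)`. -/
def objective (𝒩 : CodedNetwork N F M κ) (y : 𝒩.Primal) : ℝ :=
  ∑ m, 𝒩.utility m (y.a m) - ∑ i, 𝒩.cost i (y.pow i)

/-- The part of the constraint function that depends on `y`. -/
def conPrimal (𝒩 : CodedNetwork N F M κ) (y : 𝒩.Primal) : 𝒩.Mult :=
  WithLp.toLp 2 fun
    | .inl ⟨(mt, i), _⟩ =>
        𝒩.injection mt.1.1 mt.1.2 (y.a mt.1.1) i
          - (∑ ij : 𝒩.Edge with ij.1.1 = i, y.x mt ij)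
          + ∑ ij : 𝒩.Edge with ij.1.2 = i, y.x mt ij
    | .inr (.inl ⟨(mt, i, K), _⟩) =>
        (∑ ij : 𝒩.Edge with ij.1.1 = i ∧ ij.1.2 ∈ K, y.x mt ij)
          - ∑ e : 𝒩.Arc with e.1.1 = i ∧ (e.1.2 ∩ K).Nonempty, y.z e mt.1.1
    | .inr (.inr (.inl e)) => (∑ m, y.z e m) - y.c e
    | .inr (.inr (.inr (.inl e))) => y.c e
    | .inr (.inr (.inr (.inr i))) => - y.pow i

/-- The part of the constraint function that depends on the policy: minus the ergodic capacities in
the capacity constraints, the average powers in the power constraints, and zero elsewhere. -/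
def conPolicy (𝒩 : CodedNetwork N F M κ) (p : 𝒩.Policy) : 𝒩.Mult :=
  WithLp.toLp 2 fun
    | .inl _ => 0
    | .inr (.inl _) => 0
    | .inr (.inr (.inl _)) => 0
    | .inr (.inr (.inr (.inl e))) => - ∫ h, ∑ f, 𝒩.capacity e f (p h) h ∂𝒩.channelLaw
    | .inr (.inr (.inr (.inr i))) =>
        ∫ h, ∑ f, ∑ e : 𝒩.Arc with e.1.1 = i, p h e f ∂𝒩.channelLaw

/-- The constraint function `q(y, p)`; the constraints are `q(y, p) ≤ 0`. -/
def con (𝒩 : CodedNetwork N F M κ) (y : 𝒩.Primal) (p : 𝒩.Policy) : 𝒩.Mult :=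
  𝒩.conPrimal y + 𝒩.conPolicy p

/-- The projection `[·]⁺` onto the nonnegative orthant. -/
def proj (𝒩 : CodedNetwork N F M κ) (u : 𝒩.Mult) : 𝒩.Mult :=
  WithLp.toLp 2 fun k => max (u k) 0

/-- The optimal value `𝖯`: the supremum of the objective over all feasible pairs. -/
def optimalValue (𝒩 : CodedNetwork N F M κ) : EReal :=
  sSup {v | ∃ y p, (y, p) ∈ 𝒩.constraintSet ∧ (∀ k, 𝒩.con y p k ≤ 0) ∧
    v = (𝒩.objective y : EReal)}

/-- The standing assumptions on the network problem. -/
structure StandingAssumptions (𝒩 : CodedNetwork N F M κ) [Fintype κ] : Prop where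
  /-- the channel vector is random with nonnegative entries -/
  isProbability : IsProbabilityMeasure 𝒩.channelLaw
  nonneg : ∀ᵐ h ∂𝒩.channelLaw, ∀ k, 0 ≤ h k
  /-- the fading is continuous -/
  continuousFading : 𝒩.channelLaw ≪ volume
  utility_concave : ∀ m, ConcaveOn ℝ (Set.Icc (𝒩.rateMin m) (𝒩.rateMax m)) (𝒩.utility m)
  cost_convex : ∀ i, ConvexOn ℝ (Set.Icc 0 (𝒩.powerMax i)) (𝒩.cost i)
  powerSet_bounded : Bornology.IsBounded 𝒩.powerSet
  /-- the ergodic capacities of all policies are well defined -/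
  capacity_integrable : ∀ p ∈ 𝒩.policies, ∀ e,
    Integrable (fun h => ∑ f, 𝒩.capacity e f (p h) h) 𝒩.channelLaw
  /-- Slater's condition -/
  slater : ∃ y p, (y, p) ∈ 𝒩.constraintSet ∧ ∀ k, 𝒩.con y p k < 0

/-- `(y, p, ζ)` is a run, indexed by `ℓ = 1, 2, …`, of the asynchronous dual subgradient method with
stepsize `ε`, where at time `ℓ` the physical layer contributes the policy computed from the
multipliers at time `τ ℓ`, and the delay `ℓ - τ ℓ` is at most `D`. Only the policies `p (τ ℓ)` that
the method uses are constrained. -/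
structure IsAsyncRun (𝒩 : CodedNetwork N F M κ) (ε : ℝ) (D : ℕ) (τ : ℕ → ℕ)
    (y : ℕ → 𝒩.Primal) (p : ℕ → 𝒩.Policy) (ζ : ℕ → 𝒩.Mult) : Prop where
  one_le_delayed : ∀ ℓ, 1 ≤ ℓ → 1 ≤ τ ℓ
  delayed_le : ∀ ℓ, 1 ≤ ℓ → τ ℓ ≤ ℓ
  delay_le : ∀ ℓ, 1 ≤ ℓ → ℓ ≤ τ ℓ + D
  init_nonneg : ∀ k, 0 ≤ ζ 1 k
  /-- `y(ℓ)` maximizes the `y`-part of the Lagrangian at the current multipliers -/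
  primal_mem : ∀ ℓ, 1 ≤ ℓ → y ℓ ∈ 𝒩.box
  primal_max : ∀ ℓ, 1 ≤ ℓ →
    IsMaxOn (fun w => 𝒩.objective w - inner ℝ (ζ ℓ) (𝒩.conPrimal w)) 𝒩.box (y ℓ)
  /-- `p(τ(ℓ))` maximizes the policy part of the Lagrangian at the outdated multipliers -/
  policy_mem : ∀ ℓ, 1 ≤ ℓ → p (τ ℓ) ∈ 𝒩.policies
  policy_max : ∀ ℓ, 1 ≤ ℓ →
    IsMaxOn (fun w => - inner ℝ (ζ (τ ℓ)) (𝒩.conPolicy w)) 𝒩.policies (p (τ ℓ))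
  update : ∀ ℓ, 1 ≤ ℓ →
    ζ (ℓ + 1) = 𝒩.proj (ζ ℓ + ε • (𝒩.conPrimal (y ℓ) + 𝒩.conPolicy (p (τ ℓ))))

/-- The running average `ȳ(s) = (1/s) ∑_{ℓ=1}^s y(ℓ)`. -/
def runningAverage (𝒩 : CodedNetwork N F M κ) (y : ℕ → 𝒩.Primal) (s : ℕ) : 𝒩.Primal :=
  (1 / (s : ℝ)) • ∑ ℓ ∈ Finset.Icc 1 s, y ℓ

end CodedNetwork

end

set_option linter.unusedSectionVars false

/-! One energy estimate on the multipliers drives both the asymptotic feasibility and the lower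
bound. The projection does not increase the norm here, so ‖ζ(ℓ+1)‖² ≤ ‖ζ(ℓ)‖² + 2ε⟨ζ(ℓ), q(ℓ)⟩ +
ε²G². The pair used at time ℓ maximizes the Lagrangian up to the staleness of the policy
multipliers; these differ from ζ(ℓ) by at most DεG, which costs at most 2εDḠG. Comparison with a
feasible pair and telescoping give `sum_objective_ge`. Discarding its final norm and using concavity
yields the liminf bound. Bounding the objective above instead yields ‖ζ(s)‖ = O(√s), and the
averaged violation, dominated by ζ(s+1)/(εs), tends to zero.

The averaged constraint involves an average of values v(p), which a single policy has to reproduce.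
As the channel law does not charge hyperplanes, two policies can be time-shared by switching on an
event of suitable size. This gives convexity of the closure of the set of values
(`convex_closure_conPolicy_image`); approximation suffices because only limits are claimed.

For the limsup, mixing a nearly feasible pair with a little of the Slater point makes it exactly
feasible at small cost in the objective. -/

/-! ### Approximate Lyapunov convexity for atomless laws. -/

/-- A finite measure with a real-valued measurable function whose level sets are null can be cut
along a sublevel set in any proportion. -/
lemma exists_measureReal_inter_sublevel_eq {Ω : Type*} [MeasurableSpace Ω] {μ : Measure Ω}
    [IsFiniteMeasure μ] {X : Ω → ℝ} (hX : Measurable X) (hnull : ∀ t, μ (X ⁻¹' {t}) = 0)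
    (B : Set Ω) {c : ℝ} (h0 : 0 < c) (h1 : c < 1) :
    ∃ t, μ.real (B ∩ {ω | X ω ≤ t}) = c * μ.real B := by
  rcases (measureReal_nonneg : 0 ≤ μ.real B).eq_or_lt with hzero | hpos
  · refine ⟨0, le_antisymm ?_ ?_⟩
    · rw [← hzero, mul_zero, hzero]
      exact measureReal_mono Set.inter_subset_left
    · rw [← hzero, mul_zero]; exact measureReal_nonneg
  set ν : Measure ℝ := (μ.restrict B).map X with hν
  have hFν : ∀ t, μ.real (B ∩ {ω | X ω ≤ t}) = ν.real (Set.Iic t) := fun t => by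
    rw [hν, map_measureReal_apply hX measurableSet_Iic,
      measureReal_restrict_apply (hX measurableSet_Iic), Set.inter_comm]
    rfl
  have hBν : μ.real B = ν.real Set.univ := by
    rw [hν, map_measureReal_apply hX MeasurableSet.univ, Set.preimage_univ,
      measureReal_restrict_apply MeasurableSet.univ, Set.univ_inter]
  have hatom : NullSingletonClass ν := ⟨fun t => by
    rw [hν, Measure.map_apply hX (measurableSet_singleton t)]
    exact Measure.absolutelyContinuous_of_le Measure.restrict_le_self (hnull t)⟩
  have hcont : Continuous fun t => ν.real (Set.Iic t) := by
    -- The distribution function is a primitive of the constant 1 with respect to the atomless `ν`,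
    -- hence continuous.
    have key : ∀ t, ν.real (Set.Iic t) = ν.real (Set.Iic 0) + ∫ _ in (0 : ℝ)..t, (1 : ℝ) ∂ν := by
      intro t
      rw [← intervalIntegral.integral_Iic_sub_Iic (integrable_const _).integrableOn
        (integrable_const _).integrableOn]
      simp
    rw [funext key]
    exact continuous_const.add
      (intervalIntegral.continuous_primitive (fun a b => intervalIntegrable_const) 0)
  have htop : Tendsto (fun t => ν.real (Set.Iic t)) atTop (𝓝 (ν.real Set.univ)) :=
    (ENNReal.tendsto_toReal (measure_ne_top _ _)).comp (tendsto_measure_Iic_atTop ν)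
  have hbot : Tendsto (fun t => ν.real (Set.Iic t)) atBot (𝓝 0) := by
    have hIci : Tendsto (fun t => ν.real (Set.Ici t)) atBot (𝓝 (ν.real Set.univ)) :=
      (ENNReal.tendsto_toReal (measure_ne_top _ _)).comp (tendsto_measure_Ici_atBot ν)
    have hcompl : ∀ t, ν.real (Set.Iic t) = ν.real Set.univ - ν.real (Set.Ici t) := fun t => by
      rw [← Set.compl_Ioi, measureReal_compl measurableSet_Ioi, measureReal_congr Ioi_ae_eq_Ici]
    simpa [← hcompl] using hIci.const_sub (ν.real Set.univ)
  rw [hBν] at hpos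
  obtain ⟨t, ht⟩ : c * ν.real Set.univ ∈ Set.range fun t => ν.real (Set.Iic t) := by
    refine mem_range_of_exists_le_of_exists_ge hcont ?_ ?_
    · exact (hbot.eventually_le_const (mul_pos h0 hpos)).exists
    · exact (htop.eventually_const_le (by nlinarith)).exists
  exact ⟨t, by rw [hFν, hBν]; exact ht⟩

/-- An approximate form of Lyapunov's convexity theorem. -/
lemma exists_measurableSet_norm_setIntegral_sub_lt {Ω E : Type*} [MeasurableSpace Ω]
    [NormedAddCommGroup E] [NormedSpace ℝ E] [CompleteSpace E] {μ : Measure Ω}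
    [IsFiniteMeasure μ] {X : Ω → ℝ} (hX : Measurable X) (hnull : ∀ t, μ (X ⁻¹' {t}) = 0)
    {φ : Ω → E} (hφ : Integrable φ μ) {c : ℝ} (h0 : 0 < c) (h1 : c < 1) {δ : ℝ} (hδ : 0 < δ) :
    ∃ A, MeasurableSet A ∧ ‖∫ ω in A, φ ω ∂μ - c • ∫ ω, φ ω ∂μ‖ < δ := by
  obtain ⟨g, hg, hgm⟩ := (memLp_one_iff_integrable.2 hφ).exists_simpleFunc_eLpNorm_sub_lt
    (by simp) (ε := ENNReal.ofReal (δ / 2)) (by simpa using hδ)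
  have hgi : Integrable g μ := memLp_one_iff_integrable.1 hgm
  -- The threshold may depend on the value of the simple function `g`, so that `A` takes the
  -- fraction `c` of every fibre and treats `g` exactly.
  choose t ht using fun e : E => exists_measureReal_inter_sublevel_eq hX hnull
    (g ⁻¹' {e}) h0 h1
  set A : Set Ω := {ω | X ω ≤ t (g ω)} with hA
  have hAm : MeasurableSet A := measurableSet_le hX (g.map t).measurable
  have hgA : ∫ ω in A, g ω ∂μ = c • ∫ ω, g ω ∂μ := by
    rw [← SimpleFunc.integral_eq_integral g hgi,
      ← SimpleFunc.integral_eq_integral g hgi.integrableOn, SimpleFunc.integral_eq,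
      SimpleFunc.integral_eq, Finset.smul_sum]
    refine Finset.sum_congr rfl fun e _ => ?_
    rw [measureReal_restrict_apply (g.measurableSet_fiber e), smul_smul, ← ht e]
    congr 2
    ext ω
    simp only [hA, Set.mem_inter_iff, Set.mem_preimage, Set.mem_singleton_iff, Set.mem_ofPred_eq]
    exact and_congr_right fun h => by rw [h]
  have hlt : ∫ ω, ‖φ ω - g ω‖ ∂μ < δ / 2 := by
    rw [eLpNorm_one_eq_lintegral_enorm] at hg
    refine (integral_norm_eq_lintegral_enorm (hφ.sub hgi).1).trans_lt ?_
    exact ENNReal.toReal_lt_of_lt_ofReal hg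
  refine ⟨A, hAm, ?_⟩
  have hid : ∫ ω in A, φ ω ∂μ - c • ∫ ω, φ ω ∂μ
      = ∫ ω in A, (φ ω - g ω) ∂μ - c • ∫ ω, (φ ω - g ω) ∂μ := by
    rw [integral_sub hφ.integrableOn hgi.integrableOn, integral_sub hφ hgi, hgA, smul_sub]
    abel
  rw [hid]
  have b1 : ‖∫ ω in A, (φ ω - g ω) ∂μ‖ ≤ ∫ ω, ‖φ ω - g ω‖ ∂μ :=
    (norm_integral_le_integral_norm _).trans
      (setIntegral_le_integral (hφ.sub hgi).norm (ae_of_all _ fun _ => norm_nonneg _))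
  have b2 : ‖c • ∫ ω, (φ ω - g ω) ∂μ‖ ≤ ∫ ω, ‖φ ω - g ω‖ ∂μ := by
    rw [norm_smul, Real.norm_of_nonneg h0.le]
    refine (mul_le_of_le_one_left (norm_nonneg _) h1.le).trans (norm_integral_le_integral_norm _)
  calc _ ≤ _ := norm_sub_le _ _
    _ < δ := by linarith

/-- By continuity of (u, v) ↦ a u + b v, it is enough to place the combinations of points of `S`
itself in the closure. -/
lemma convex_closure_of_forall_exists_norm_sub_lt {E : Type*} [NormedAddCommGroup E]
    [NormedSpace ℝ E] {S : Set E}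
    (h : ∀ x ∈ S, ∀ y ∈ S, ∀ a b : ℝ, 0 < a → 0 < b → a + b = 1 → ∀ δ > 0,
      ∃ z ∈ S, ‖z - (a • x + b • y)‖ < δ) : Convex ℝ (closure S) := by
  refine convex_iff_forall_pos.2 fun x hx y hy a b ha hb hab => ?_
  rw [← closure_closure]
  refine map_mem_closure₂ (f := fun u v : E => a • u + b • v) (by fun_prop) hx hy
    fun u hu v hv => Metric.mem_closure_iff.2 fun δ hδ => ?_
  obtain ⟨z, hz, hlt⟩ := h u hu v hv a b ha hb hab δ hδ
  exact ⟨z, hz, by rwa [dist_comm, dist_eq_norm]⟩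

namespace CodedNetwork

variable {N F M κ : Type*} [Fintype N] [DecidableEq N] [Fintype F] [Fintype M]

/-! ### Time sharing between policies. -/

/-- The integrand of the expectation terms in the constraints. -/
noncomputable def policyIntegrand (𝒩 : CodedNetwork N F M κ) (p : 𝒩.Policy) (h : κ → ℝ) :
    𝒩.Mult :=
  WithLp.toLp 2 fun
    | .inl _ => 0
    | .inr (.inl _) => 0
    | .inr (.inr (.inl _)) => 0
    | .inr (.inr (.inr (.inl e))) => - ∑ f, 𝒩.capacity e f (p h) h
    | .inr (.inr (.inr (.inr i))) => ∑ f, ∑ e : 𝒩.Arc with e.1.1 = i, p h e f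

lemma integrable_policyIntegrand [Fintype κ] {𝒩 : CodedNetwork N F M κ}
    (h𝒩 : 𝒩.StandingAssumptions) {p : 𝒩.Policy} (hp : p ∈ 𝒩.policies) :
    Integrable (𝒩.policyIntegrand p) 𝒩.channelLaw := by
  have := h𝒩.isProbability
  refine Integrable.of_eval_piLp fun k => ?_
  rcases k with _ | _ | _ | e | i
  · exact integrable_zero _ _ _
  · exact integrable_zero _ _ _
  · exact integrable_zero _ _ _
  · exact (h𝒩.capacity_integrable p hp e).neg
  · refine integrable_finsetSum _ fun f _ => integrable_finsetSum _ fun e _ => ?_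
    obtain ⟨R, hR⟩ := h𝒩.powerSet_bounded.exists_norm_le
    refine Integrable.of_bound (C := R) ?_ ?_
    · have : Measurable fun h => p h e f :=
        (measurable_pi_apply f).comp ((measurable_pi_apply e).comp hp.1)
      exact this.aestronglyMeasurable
    · filter_upwards [hp.2] with h hh
      exact (norm_le_pi_norm (p h e) f).trans ((norm_le_pi_norm (p h) e).trans (hR _ hh))

lemma conPolicy_eq_integral [Fintype κ] {𝒩 : CodedNetwork N F M κ}
    (h𝒩 : 𝒩.StandingAssumptions) {p : 𝒩.Policy} (hp : p ∈ 𝒩.policies) :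
    𝒩.conPolicy p = ∫ h, 𝒩.policyIntegrand p h ∂𝒩.channelLaw := by
  ext k
  rw [eval_integral_piLp (integrable_policyIntegrand h𝒩 hp).eval_piLp]
  rcases k with _ | _ | _ | e | i
  · exact (integral_zero _ _).symm
  · exact (integral_zero _ _).symm
  · exact (integral_zero _ _).symm
  · exact (integral_neg _).symm
  · rfl

/-- Because the fading is continuous, time sharing between policies can be emulated by a policy. -/
lemma convex_closure_conPolicy_image [Fintype κ] [Nonempty κ] {𝒩 : CodedNetwork N F M κ}
    (h𝒩 : 𝒩.StandingAssumptions) : Convex ℝ (closure (𝒩.conPolicy '' 𝒩.policies)) := by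
  classical
  have := h𝒩.isProbability
  refine convex_closure_of_forall_exists_norm_sub_lt ?_
  rintro _ ⟨p, hp, rfl⟩ _ ⟨q, hq, rfl⟩ a b ha hb hab δ hδ
  obtain ⟨k⟩ := ‹Nonempty κ›
  have ip := integrable_policyIntegrand h𝒩 hp
  have iq := integrable_policyIntegrand h𝒩 hq
  -- A level set of one channel coordinate is a Lebesgue-null hyperplane. Cutting the difference of
  -- the integrands in proportion `a` and adding back the integral for `q` gives the mixture.
  obtain ⟨A, hA, hlt⟩ := exists_measurableSet_norm_setIntegral_sub_lt (μ := 𝒩.channelLaw)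
    (X := fun h => h k) (measurable_pi_apply k)
    (fun t => h𝒩.continuousFading (Measure.pi_hyperplane (fun _ : κ => (volume : Measure ℝ)) k t))
    (ip.sub iq) ha (by linarith : a < 1) hδ
  have hr : A.piecewise p q ∈ 𝒩.policies := by
    refine ⟨hp.1.piecewise hA hq.1, ?_⟩
    filter_upwards [hp.2, hq.2] with h h1 h2
    by_cases hh : h ∈ A <;> simp [hh, h1, h2]
  refine ⟨_, ⟨_, hr, rfl⟩, ?_⟩
  convert hlt using 2
  have hpw : 𝒩.policyIntegrand (A.piecewise p q)
      = A.piecewise (𝒩.policyIntegrand p) (𝒩.policyIntegrand q) := by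
    ext1 h
    by_cases hh : h ∈ A <;> simp [policyIntegrand, hh]
  have hb' : b = 1 - a := by linarith
  simp only [conPolicy_eq_integral h𝒩 hr, conPolicy_eq_integral h𝒩 hp,
    conPolicy_eq_integral h𝒩 hq, hpw, Pi.sub_apply]
  rw [integral_piecewise hA ip.integrableOn iq.integrableOn,
    integral_sub ip.integrableOn iq.integrableOn, integral_sub ip iq,
    ← integral_add_compl hA iq, hb']
  module

/-! ### Linearity, concavity and the projection. -/

lemma conPrimal_add (𝒩 : CodedNetwork N F M κ) (u v : 𝒩.Primal) :
    𝒩.conPrimal (u + v) = 𝒩.conPrimal u + 𝒩.conPrimal v := by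
  ext k
  rcases k with ⟨⟨mt, i⟩, hk⟩ | ⟨⟨mt, i, K⟩, hk⟩ | e | e | i
  · simp only [conPrimal, injection, Primal.a, Primal.x, Pi.add_apply, PiLp.add_apply,
      Finset.sum_add_distrib]
    split_ifs <;> ring
  · simp only [conPrimal, Primal.z, Primal.x, Pi.add_apply, PiLp.add_apply,
      Finset.sum_add_distrib]
    ring
  · simp only [conPrimal, Primal.z, Primal.c, Pi.add_apply, PiLp.add_apply,
      Finset.sum_add_distrib]
    ring
  · rfl
  · simp only [conPrimal, Primal.pow, Pi.add_apply, PiLp.add_apply]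
    ring

lemma conPrimal_smul (𝒩 : CodedNetwork N F M κ) (r : ℝ) (u : 𝒩.Primal) :
    𝒩.conPrimal (r • u) = r • 𝒩.conPrimal u := by
  ext k
  rcases k with ⟨⟨mt, i⟩, hk⟩ | ⟨⟨mt, i, K⟩, hk⟩ | e | e | i
  · simp only [conPrimal, injection, Primal.a, Primal.x, Pi.smul_apply, PiLp.smul_apply,
      smul_eq_mul, ← Finset.mul_sum]
    split_ifs <;> ring
  · simp only [conPrimal, Primal.z, Primal.x, Pi.smul_apply, PiLp.smul_apply,
      smul_eq_mul, ← Finset.mul_sum]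
    ring
  · simp only [conPrimal, Primal.z, Primal.c, Pi.smul_apply, PiLp.smul_apply,
      smul_eq_mul, ← Finset.mul_sum]
    ring
  · rfl
  · simp only [conPrimal, Primal.pow, Pi.smul_apply, PiLp.smul_apply, smul_eq_mul]
    ring

/-- `conPrimal` as a linear map. -/
noncomputable def conPrimalLinear (𝒩 : CodedNetwork N F M κ) : 𝒩.Primal →ₗ[ℝ] 𝒩.Mult where
  toFun := 𝒩.conPrimal
  map_add' := 𝒩.conPrimal_add
  map_smul' := 𝒩.conPrimal_smul

lemma convex_box (𝒩 : CodedNetwork N F M κ) : Convex ℝ 𝒩.box := by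
  intro u hu v hv a b ha hb hab
  obtain ⟨u1, u2, u3, u4, u5⟩ := hu
  obtain ⟨v1, v2, v3, v4, v5⟩ := hv
  have key : ∀ l r s t : ℝ, l ≤ s ∧ s ≤ r → l ≤ t ∧ t ≤ r →
      l ≤ a * s + b * t ∧ a * s + b * t ≤ r := fun l r s t hs ht =>
    convex_Icc l r hs ht ha hb hab
  exact ⟨fun m => key _ _ _ _ (u1 m) (v1 m), fun e m => key _ _ _ _ (u2 e m) (v2 e m),
    fun mt ij => key _ _ _ _ (u3 mt ij) (v3 mt ij), fun e => key _ _ _ _ (u4 e) (v4 e),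
    fun i => key _ _ _ _ (u5 i) (v5 i)⟩

lemma concaveOn_objective [Fintype κ] {𝒩 : CodedNetwork N F M κ} (h𝒩 : 𝒩.StandingAssumptions) :
    ConcaveOn ℝ 𝒩.box 𝒩.objective := by
  refine ⟨𝒩.convex_box, fun u hu v hv a b ha hb hab => ?_⟩
  have h1 : ∑ m, (a * 𝒩.utility m (u.a m) + b * 𝒩.utility m (v.a m))
      ≤ ∑ m, 𝒩.utility m (Primal.a (a • u + b • v) m) :=
    Finset.sum_le_sum fun m _ => (h𝒩.utility_concave m).2 (hu.1 m) (hv.1 m) ha hb hab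
  have h2 : ∑ i, 𝒩.cost i (Primal.pow (a • u + b • v) i)
      ≤ ∑ i, (a * 𝒩.cost i (u.pow i) + b * 𝒩.cost i (v.pow i)) :=
    Finset.sum_le_sum fun i _ =>
      (h𝒩.cost_convex i).2 (hu.2.2.2.2 i) (hv.2.2.2.2 i) ha hb hab
  simp only [Finset.sum_add_distrib, ← Finset.mul_sum] at h1 h2
  simp only [objective, smul_eq_mul]
  linarith

lemma norm_proj_sub_proj_le (𝒩 : CodedNetwork N F M κ) (u v : 𝒩.Mult) :
    ‖𝒩.proj u - 𝒩.proj v‖ ≤ ‖u - v‖ := by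
  rw [EuclideanSpace.norm_eq, EuclideanSpace.norm_eq]
  refine Real.sqrt_le_sqrt (Finset.sum_le_sum fun k _ => ?_)
  exact pow_le_pow_left₀ (norm_nonneg _) (abs_max_sub_max_le_abs (u k) (v k) 0) 2

lemma norm_proj_le_of_le (𝒩 : CodedNetwork N F M κ) {u v : 𝒩.Mult} (h : ∀ k, u k ≤ v k) :
    ‖𝒩.proj u‖ ≤ ‖v‖ := by
  rw [EuclideanSpace.norm_eq, EuclideanSpace.norm_eq]
  refine Real.sqrt_le_sqrt (Finset.sum_le_sum fun k _ => ?_)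
  refine pow_le_pow_left₀ (norm_nonneg _) ?_ 2
  change |max (u k) 0| ≤ |v k|
  rw [abs_of_nonneg (le_max_right _ _)]
  exact max_le ((h k).trans (le_abs_self _)) (abs_nonneg _)

lemma proj_of_nonneg (𝒩 : CodedNetwork N F M κ) {u : 𝒩.Mult} (h : ∀ k, 0 ≤ u k) :
    𝒩.proj u = u := by
  ext k
  exact max_eq_left (h k)

/-! ### Upper bound through the Slater point. -/

/-- Every convex combination of policy constraint values is approximated by that of a policy. -/
lemma exists_policy_conPolicy_near [Fintype κ] [Nonempty κ] {𝒩 : CodedNetwork N F M κ}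
    (h𝒩 : 𝒩.StandingAssumptions) {v : 𝒩.Mult}
    (hv : v ∈ convexHull ℝ (𝒩.conPolicy '' 𝒩.policies)) {δ : ℝ} (hδ : 0 < δ) :
    ∃ r ∈ 𝒩.policies, ‖𝒩.conPolicy r - v‖ < δ := by
  have : v ∈ closure (𝒩.conPolicy '' 𝒩.policies) :=
    convexHull_min subset_closure (convex_closure_conPolicy_image h𝒩) hv
  obtain ⟨_, ⟨r, hr, rfl⟩, hlt⟩ := Metric.mem_closure_iff.1 this δ hδ
  exact ⟨r, hr, by rwa [← dist_eq_norm, dist_comm]⟩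

/-- The optimal value bounds the objective along asymptotically feasible sequences. -/
lemma limsup_objective_le_optimalValue [Fintype κ] [Nonempty κ] {𝒩 : CodedNetwork N F M κ}
    (h𝒩 : 𝒩.StandingAssumptions) {u : ℕ → 𝒩.Primal} {r : ℕ → 𝒩.Policy}
    (hmem : ∀ᶠ s in atTop, (u s, r s) ∈ 𝒩.constraintSet)
    (hlim : Tendsto (fun s => ‖𝒩.proj (𝒩.con (u s) (r s))‖) atTop (𝓝 0)) :
    limsup (fun s => (𝒩.objective (u s) : EReal)) atTop ≤ 𝒩.optimalValue := by
  obtain ⟨y', p', hyp', hslater⟩ := h𝒩.slater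
  have hle : ∀ w r, (w, r) ∈ 𝒩.constraintSet → (∀ k, 𝒩.con w r k ≤ 0) →
      (𝒩.objective w : EReal) ≤ 𝒩.optimalValue := fun w r h1 h2 => le_sSup ⟨w, r, h1, h2, rfl⟩
  refine EReal.le_of_forall_lt_iff_le.1 fun b hb => ?_
  have hP' := hle y' p' hyp' fun k => (hslater k).le
  -- The optimal value is finite: it lies below `b` and above the Slater objective.
  obtain ⟨P, hP⟩ : ∃ P : ℝ, 𝒩.optimalValue = P :=
    ⟨_, (EReal.coe_toReal (hb.trans_le le_top).ne
      ((EReal.bot_lt_coe _).trans_le hP').ne').symm⟩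
  rw [hP, EReal.coe_lt_coe_iff] at hb
  obtain ⟨δ, hδ0, hδ⟩ : ∃ δ : ℝ, 0 < δ ∧ ∀ k, 𝒩.con y' p' k ≤ -δ := by
    have h : ∀ᶠ δ in 𝓝[>] (0 : ℝ), 0 < δ ∧ ∀ k, 𝒩.con y' p' k ≤ -δ := by
      refine eventually_mem_nhdsWithin.and (eventually_all.2 fun k => ?_)
      filter_upwards [Ioo_mem_nhdsGT (neg_pos.2 (hslater k))] with δ hδ
      linarith [hδ.2]
    exact h.exists
  -- The weight `θ` of the Slater point is small enough that mixing it with an objective above `b`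
  -- still exceeds `P`.
  obtain ⟨θ, ⟨hθ0, hθ1⟩, hθ⟩ : ∃ θ : ℝ, θ ∈ Set.Ioo (0 : ℝ) 1 ∧
      P < (1 - θ) * b + θ * 𝒩.objective y' := by
    have hc : Continuous fun θ : ℝ => (1 - θ) * b + θ * 𝒩.objective y' := by fun_prop
    have h := (hc.tendsto 0).eventually_const_lt (u := P) (by simpa using hb)
    have h1 : ∀ᶠ θ in 𝓝[>] (0 : ℝ), θ ∈ Set.Ioo (0 : ℝ) 1 := Ioo_mem_nhdsGT one_pos
    exact (h1.and (nhdsWithin_le_nhds h)).exists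
  -- The Slater part contributes -θδ: one half absorbs the residual violation, the other the error
  -- of emulating the mixed policy.
  have hslack : 0 < θ * δ / 2 := by positivity
  refine limsup_le_of_le (h := ?_)
  filter_upwards [hmem, hlim.eventually_lt_const hslack] with s hs hsmall
  rw [EReal.coe_le_coe_iff]
  by_contra! hlt
  obtain ⟨q, hq, hqlt⟩ := exists_policy_conPolicy_near h𝒩
    (convex_convexHull ℝ _ (subset_convexHull ℝ _ (Set.mem_image_of_mem 𝒩.conPolicy hs.2))
      (subset_convexHull ℝ _ (Set.mem_image_of_mem 𝒩.conPolicy hyp'.2)) (sub_nonneg.2 hθ1.le) hθ0.le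
      (sub_add_cancel 1 θ)) hslack
  have hbox := 𝒩.convex_box hs.1 hyp'.1 (sub_nonneg.2 hθ1.le) hθ0.le (sub_add_cancel 1 θ)
  have hfeas : ∀ k, 𝒩.con ((1 - θ) • u s + θ • y') q k ≤ 0 := fun k => by
    have e1 : 𝒩.con ((1 - θ) • u s + θ • y') q
        = (1 - θ) • 𝒩.con (u s) (r s) + θ • 𝒩.con y' p'
          + (𝒩.conPolicy q - ((1 - θ) • 𝒩.conPolicy (r s) + θ • 𝒩.conPolicy p')) := by
      simp only [con, conPrimal_add, conPrimal_smul]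
      module
    have e2 := (le_abs_self _).trans ((PiLp.norm_apply_le
      (𝒩.conPolicy q - ((1 - θ) • 𝒩.conPolicy (r s) + θ • 𝒩.conPolicy p')) k).trans hqlt.le)
    have e3 : 𝒩.con (u s) (r s) k ≤ θ * δ / 2 :=
      ((le_max_left _ 0).trans (le_abs_self _)).trans
        ((PiLp.norm_apply_le (𝒩.proj (𝒩.con (u s) (r s))) k).trans hsmall.le)
    rw [e1, PiLp.add_apply, PiLp.add_apply, PiLp.smul_apply, PiLp.smul_apply, smul_eq_mul,
      smul_eq_mul]
    have e4 : (1 - θ) * 𝒩.con (u s) (r s) k ≤ θ * δ / 2 := by nlinarith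
    nlinarith [hδ k]
  have h1 := hle _ q ⟨hbox, hq⟩ hfeas
  rw [hP, EReal.coe_le_coe_iff] at h1
  have h2 := (concaveOn_objective h𝒩).2 hs.1 hyp'.1 (sub_nonneg.2 hθ1.le) hθ0.le
    (sub_add_cancel 1 θ)
  simp only [smul_eq_mul] at h2
  nlinarith

namespace IsAsyncRun

variable {𝒩 : CodedNetwork N F M κ} {G Gbar ε : ℝ} {D : ℕ} {τ : ℕ → ℕ} {y : ℕ → 𝒩.Primal}
  {p : ℕ → 𝒩.Policy} {ζ : ℕ → 𝒩.Mult}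

/-! ### Multiplier dynamics and the energy estimate. -/

lemma mem_constraintSet (hrun : 𝒩.IsAsyncRun ε D τ y p ζ) {ℓ : ℕ} (hℓ : 1 ≤ ℓ) :
    (y ℓ, p (τ ℓ)) ∈ 𝒩.constraintSet :=
  ⟨hrun.primal_mem ℓ hℓ, hrun.policy_mem ℓ hℓ⟩

lemma update_con (hrun : 𝒩.IsAsyncRun ε D τ y p ζ) {ℓ : ℕ} (hℓ : 1 ≤ ℓ) :
    ζ (ℓ + 1) = 𝒩.proj (ζ ℓ + ε • 𝒩.con (y ℓ) (p (τ ℓ))) :=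
  hrun.update ℓ hℓ

lemma multiplier_nonneg (hrun : 𝒩.IsAsyncRun ε D τ y p ζ) {ℓ : ℕ} (hℓ : 1 ≤ ℓ) :
    ∀ k, 0 ≤ ζ ℓ k := by
  induction ℓ, hℓ using Nat.le_induction with
  | base => exact hrun.init_nonneg
  | succ ℓ hℓ _ =>
    intro k
    rw [hrun.update_con hℓ]
    exact le_max_right _ _

lemma norm_multiplier_step_le (hrun : 𝒩.IsAsyncRun ε D τ y p ζ) (hε : 0 < ε)
    (hG : ∀ y p, (y, p) ∈ 𝒩.constraintSet → ‖𝒩.con y p‖ ≤ G) {ℓ : ℕ} (hℓ : 1 ≤ ℓ) :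
    ‖ζ (ℓ + 1) - ζ ℓ‖ ≤ ε * G := by
  have h := 𝒩.norm_proj_sub_proj_le (ζ ℓ + ε • 𝒩.con (y ℓ) (p (τ ℓ))) (ζ ℓ)
  rw [← hrun.update_con hℓ, 𝒩.proj_of_nonneg (hrun.multiplier_nonneg hℓ), add_sub_cancel_left,
    norm_smul, Real.norm_of_nonneg hε.le] at h
  exact h.trans (mul_le_mul_of_nonneg_left (hG _ _ (hrun.mem_constraintSet hℓ)) hε.le)

lemma norm_multiplier_sub_le (hrun : 𝒩.IsAsyncRun ε D τ y p ζ) (hε : 0 < ε)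
    (hG : ∀ y p, (y, p) ∈ 𝒩.constraintSet → ‖𝒩.con y p‖ ≤ G) {ℓ : ℕ} (hℓ : 1 ≤ ℓ) (n : ℕ) :
    ‖ζ (ℓ + n) - ζ ℓ‖ ≤ n * (ε * G) := by
  induction n with
  | zero => simp
  | succ n ih =>
    have h := hrun.norm_multiplier_step_le hε hG (ℓ := ℓ + n) (by omega)
    have h' := norm_sub_le_norm_sub_add_norm_sub (ζ (ℓ + n + 1)) (ζ (ℓ + n)) (ζ ℓ)
    push_cast
    rw [← add_assoc]
    linarith

lemma norm_multiplier_sub_delayed_le (hrun : 𝒩.IsAsyncRun ε D τ y p ζ) (hε : 0 < ε)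
    (hG : ∀ y p, (y, p) ∈ 𝒩.constraintSet → ‖𝒩.con y p‖ ≤ G) {ℓ : ℕ} (hℓ : 1 ≤ ℓ) :
    ‖ζ ℓ - ζ (τ ℓ)‖ ≤ D * (ε * G) := by
  have h := hrun.norm_multiplier_sub_le hε hG (hrun.one_le_delayed ℓ hℓ) (ℓ - τ ℓ)
  rw [Nat.add_sub_cancel' (hrun.delayed_le ℓ hℓ)] at h
  have hG0 : 0 ≤ G := (norm_nonneg _).trans (hG _ _ (hrun.mem_constraintSet hℓ))
  refine h.trans (mul_le_mul_of_nonneg_right ?_ (mul_nonneg hε.le hG0))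
  exact_mod_cast Nat.sub_le_iff_le_add'.2 (hrun.delay_le ℓ hℓ)

lemma norm_sq_multiplier_succ_le (hrun : 𝒩.IsAsyncRun ε D τ y p ζ) (hε : 0 < ε)
    (hG : ∀ y p, (y, p) ∈ 𝒩.constraintSet → ‖𝒩.con y p‖ ≤ G) {ℓ : ℕ} (hℓ : 1 ≤ ℓ) :
    ‖ζ (ℓ + 1)‖ ^ 2 ≤ ‖ζ ℓ‖ ^ 2 + 2 * ε * inner ℝ (ζ ℓ) (𝒩.con (y ℓ) (p (τ ℓ)))
      + ε ^ 2 * G ^ 2 := by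
  have h : ‖ζ (ℓ + 1)‖ ≤ ‖ζ ℓ + ε • 𝒩.con (y ℓ) (p (τ ℓ))‖ := by
    rw [hrun.update_con hℓ]
    exact 𝒩.norm_proj_le_of_le fun k => le_rfl
  refine (pow_le_pow_left₀ (norm_nonneg _) h 2).trans ?_
  rw [norm_add_sq_real, inner_smul_right, norm_smul, Real.norm_of_nonneg hε.le, mul_pow]
  have := mul_le_mul_of_nonneg_left (pow_le_pow_left₀ (norm_nonneg _)
    (hG _ _ (hrun.mem_constraintSet hℓ)) 2) (sq_nonneg ε)
  linarith

/-- The pair used at time `ℓ` almost maximizes the Lagrangian at the current multipliers. -/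
lemma objective_add_inner_le (hrun : 𝒩.IsAsyncRun ε D τ y p ζ) (hε : 0 < ε)
    (hG : ∀ y p, (y, p) ∈ 𝒩.constraintSet → ‖𝒩.con y p‖ ≤ G)
    (hGbar : ∀ p ∈ 𝒩.policies, ‖𝒩.conPolicy p‖ ≤ Gbar)
    {w : 𝒩.Primal} {r : 𝒩.Policy} (hwr : (w, r) ∈ 𝒩.constraintSet)
    (hfeas : ∀ k, 𝒩.con w r k ≤ 0) {ℓ : ℕ} (hℓ : 1 ≤ ℓ) :
    𝒩.objective w + inner ℝ (ζ ℓ) (𝒩.con (y ℓ) (p (τ ℓ))) - 2 * ε * D * Gbar * G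
      ≤ 𝒩.objective (y ℓ) := by
  have h1 : 𝒩.objective w - inner ℝ (ζ ℓ) (𝒩.conPrimal w)
      ≤ 𝒩.objective (y ℓ) - inner ℝ (ζ ℓ) (𝒩.conPrimal (y ℓ)) := hrun.primal_max ℓ hℓ hwr.1
  have h2 : -inner ℝ (ζ (τ ℓ)) (𝒩.conPolicy r)
      ≤ -inner ℝ (ζ (τ ℓ)) (𝒩.conPolicy (p (τ ℓ))) := hrun.policy_max ℓ hℓ hwr.2
  -- The price of the delay: replacing ζ(τ ℓ) by ζ(ℓ) in the comparison of policies leaves only this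
  -- cross term.
  have h3 : inner ℝ (ζ ℓ - ζ (τ ℓ)) (𝒩.conPolicy (p (τ ℓ)) - 𝒩.conPolicy r)
      ≤ (D * (ε * G)) * (Gbar + Gbar) := by
    refine (real_inner_le_norm _ _).trans (mul_le_mul
      (hrun.norm_multiplier_sub_delayed_le hε hG hℓ) ((norm_sub_le _ _).trans (add_le_add
      (hGbar _ (hrun.policy_mem ℓ hℓ)) (hGbar _ hwr.2))) (norm_nonneg _) ?_)
    exact (norm_nonneg _).trans (hrun.norm_multiplier_sub_delayed_le hε hG hℓ)
  have h4 : inner ℝ (ζ ℓ) (𝒩.con w r) ≤ 0 := by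
    rw [PiLp.inner_apply]
    refine Finset.sum_nonpos fun k _ => ?_
    exact mul_nonpos_of_nonpos_of_nonneg (hfeas k) (hrun.multiplier_nonneg hℓ k)
  simp only [inner_sub_left, inner_sub_right] at h3
  simp only [con, inner_add_right] at h4 ⊢
  linarith

/-- No continuity is needed: `y 1` maximizes the Lagrangian at `ζ 1`, and the linear term is bounded
on the box because `con` is, with the policy held fixed. -/
lemma bddAbove_objective_box [Fintype κ] (h𝒩 : 𝒩.StandingAssumptions)
    (hrun : 𝒩.IsAsyncRun ε D τ y p ζ)
    (hG : ∀ y p, (y, p) ∈ 𝒩.constraintSet → ‖𝒩.con y p‖ ≤ G) :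
    ∃ C, ∀ w ∈ 𝒩.box, 𝒩.objective w ≤ C := by
  obtain ⟨y', p', hyp', -⟩ := h𝒩.slater
  refine ⟨𝒩.objective (y 1) - inner ℝ (ζ 1) (𝒩.conPrimal (y 1))
    + ‖ζ 1‖ * (G + ‖𝒩.conPolicy p'‖), fun w hw => ?_⟩
  have h1 : 𝒩.objective w - inner ℝ (ζ 1) (𝒩.conPrimal w)
      ≤ 𝒩.objective (y 1) - inner ℝ (ζ 1) (𝒩.conPrimal (y 1)) := hrun.primal_max 1 le_rfl hw
  have h2 : ‖𝒩.conPrimal w‖ ≤ G + ‖𝒩.conPolicy p'‖ := by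
    rw [← add_sub_cancel_right (𝒩.conPrimal w) (𝒩.conPolicy p')]
    exact (norm_sub_le _ _).trans (add_le_add_left (hG w p' ⟨hw, hyp'.2⟩) _)
  have h3 := (real_inner_le_norm (ζ 1) (𝒩.conPrimal w)).trans
    (mul_le_mul_of_nonneg_left h2 (norm_nonneg _))
  linarith

/-- The final norm is kept because it serves twice: dropped for the liminf bound, isolated for the
growth of the multipliers. -/
lemma sum_objective_ge (hrun : 𝒩.IsAsyncRun ε D τ y p ζ) (hε : 0 < ε)
    (hG : ∀ y p, (y, p) ∈ 𝒩.constraintSet → ‖𝒩.con y p‖ ≤ G)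
    (hGbar : ∀ p ∈ 𝒩.policies, ‖𝒩.conPolicy p‖ ≤ Gbar)
    {w : 𝒩.Primal} {r : 𝒩.Policy} (hwr : (w, r) ∈ 𝒩.constraintSet)
    (hfeas : ∀ k, 𝒩.con w r k ≤ 0) (s : ℕ) :
    s * (𝒩.objective w - (ε * G ^ 2 / 2 + 2 * ε * D * Gbar * G))
        + (‖ζ (s + 1)‖ ^ 2 - ‖ζ 1‖ ^ 2) / (2 * ε)
      ≤ ∑ ℓ ∈ Finset.Icc 1 s, 𝒩.objective (y ℓ) := by
  induction s with
  | zero => simp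
  | succ s ih =>
    rw [Finset.sum_Icc_succ_top (by omega)]
    have hs : 1 ≤ s + 1 := by omega
    have h1 := hrun.objective_add_inner_le hε hG hGbar hwr hfeas hs
    have h2 := hrun.norm_sq_multiplier_succ_le hε hG hs
    have h3 : (‖ζ (s + 1 + 1)‖ ^ 2 - ‖ζ (s + 1)‖ ^ 2) / (2 * ε)
        ≤ inner ℝ (ζ (s + 1)) (𝒩.con (y (s + 1)) (p (τ (s + 1)))) + ε * G ^ 2 / 2 := by
      rw [div_le_iff₀ (by positivity)]
      linarith
    have h4 : (‖ζ (s + 1 + 1)‖ ^ 2 - ‖ζ 1‖ ^ 2) / (2 * ε)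
        = (‖ζ (s + 1 + 1)‖ ^ 2 - ‖ζ (s + 1)‖ ^ 2) / (2 * ε)
          + (‖ζ (s + 1)‖ ^ 2 - ‖ζ 1‖ ^ 2) / (2 * ε) := by ring
    push_cast
    linarith

/-- Each projection can only raise a coordinate, so the multiplier dominates the accumulated
violation. -/
lemma sum_con_le_multiplier (hrun : 𝒩.IsAsyncRun ε D τ y p ζ) (s : ℕ) (k : 𝒩.Con) :
    (ε • ∑ ℓ ∈ Finset.Icc 1 s, 𝒩.con (y ℓ) (p (τ ℓ))) k ≤ ζ (s + 1) k := by
  induction s with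
  | zero => simpa using hrun.init_nonneg k
  | succ s ih =>
    rw [Finset.sum_Icc_succ_top (by omega), smul_add, PiLp.add_apply,
      hrun.update_con (by omega : 1 ≤ s + 1)]
    exact (add_le_add_left ih _).trans (le_max_left _ _)

/-- The multipliers grow sublinearly. -/
lemma tendsto_norm_multiplier_div [Fintype κ] (h𝒩 : 𝒩.StandingAssumptions)
    (hrun : 𝒩.IsAsyncRun ε D τ y p ζ) (hε : 0 < ε)
    (hG : ∀ y p, (y, p) ∈ 𝒩.constraintSet → ‖𝒩.con y p‖ ≤ G)
    (hGbar : ∀ p ∈ 𝒩.policies, ‖𝒩.conPolicy p‖ ≤ Gbar) :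
    Tendsto (fun s : ℕ => ‖ζ (s + 1)‖ / s) atTop (𝓝 0) := by
  obtain ⟨y', p', hyp', hslater⟩ := h𝒩.slater
  obtain ⟨C, hC⟩ := hrun.bddAbove_objective_box h𝒩 hG
  -- The Slater pair serves only as a feasible comparison; with objectives at most `C`, the squared
  -- norm grows at most linearly with slope `B`.
  set B : ℝ := 2 * ε * (C - (𝒩.objective y' - (ε * G ^ 2 / 2 + 2 * ε * D * Gbar * G))) with hB
  have hbound : ∀ s : ℕ, ‖ζ (s + 1)‖ ^ 2 ≤ ‖ζ 1‖ ^ 2 + s * B := fun s => by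
    have h1 := hrun.sum_objective_ge hε hG hGbar hyp' (fun k => (hslater k).le) s
    have h2 : ∑ ℓ ∈ Finset.Icc 1 s, 𝒩.objective (y ℓ) ≤ s * C := by
      have := Finset.sum_le_card_nsmul (Finset.Icc 1 s) (fun ℓ => 𝒩.objective (y ℓ)) C
        fun ℓ hℓ => hC _ (hrun.primal_mem ℓ (Finset.mem_Icc.1 hℓ).1)
      simpa using this
    have h3 : (‖ζ (s + 1)‖ ^ 2 - ‖ζ 1‖ ^ 2) / (2 * ε)
        ≤ s * (C - (𝒩.objective y' - (ε * G ^ 2 / 2 + 2 * ε * D * Gbar * G))) := by linarith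
    rw [div_le_iff₀ (by positivity)] at h3
    rw [hB]
    linarith
  have hinv := tendsto_inv_atTop_nhds_zero_nat (𝕜 := ℝ)
  have hmaj : Tendsto (fun s : ℕ => √((‖ζ 1‖ ^ 2 * (s : ℝ)⁻¹ + B) * (s : ℝ)⁻¹)) atTop (𝓝 0) := by
    have h := (((hinv.const_mul (‖ζ 1‖ ^ 2)).add_const B).mul hinv).sqrt
    simpa using h
  refine squeeze_zero' (Eventually.of_forall fun s => by positivity) ?_ hmaj
  filter_upwards [eventually_gt_atTop 0] with s hs
  have hs' : (0 : ℝ) < s := by exact_mod_cast hs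
  refine Real.le_sqrt_of_sq_le ?_
  rw [div_pow, div_le_iff₀ (by positivity)]
  refine (hbound s).trans_eq ?_
  field_simp

/-! ### Running averages: feasibility and lower bound. -/

lemma runningAverage_eq_sum (y : ℕ → 𝒩.Primal) (s : ℕ) :
    𝒩.runningAverage y s = ∑ ℓ ∈ Finset.Icc 1 s, (1 / (s : ℝ)) • y ℓ :=
  Finset.smul_sum

lemma sum_weights_eq_one {s : ℕ} (hs : 1 ≤ s) :
    ∑ _ℓ ∈ Finset.Icc 1 s, (1 / (s : ℝ)) = 1 := by
  have : (s : ℝ) ≠ 0 := by exact_mod_cast (by omega : s ≠ 0)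
  simp [this]

lemma runningAverage_mem_box (hrun : 𝒩.IsAsyncRun ε D τ y p ζ) {s : ℕ} (hs : 1 ≤ s) :
    𝒩.runningAverage y s ∈ 𝒩.box := by
  rw [runningAverage_eq_sum]
  exact 𝒩.convex_box.sum_mem (fun _ _ => by positivity) (sum_weights_eq_one hs)
    fun ℓ hℓ => hrun.primal_mem ℓ (Finset.mem_Icc.1 hℓ).1

lemma sum_objective_le_runningAverage [Fintype κ] (h𝒩 : 𝒩.StandingAssumptions)
    (hrun : 𝒩.IsAsyncRun ε D τ y p ζ) {s : ℕ} (hs : 1 ≤ s) :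
    (∑ ℓ ∈ Finset.Icc 1 s, 𝒩.objective (y ℓ)) / s ≤ 𝒩.objective (𝒩.runningAverage y s) := by
  have h := (concaveOn_objective h𝒩).le_map_sum (t := Finset.Icc 1 s)
    (w := fun _ => 1 / (s : ℝ)) (p := y) (fun _ _ => by positivity) (sum_weights_eq_one hs)
    fun ℓ hℓ => hrun.primal_mem ℓ (Finset.mem_Icc.1 hℓ).1
  rw [runningAverage_eq_sum]
  refine le_trans (le_of_eq ?_) h
  rw [← Finset.smul_sum, smul_eq_mul]
  ring

/-- Averaged policies can be emulated, so the running averages are asymptotically feasible. -/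
lemma exists_policies_asymptotically_feasible [Fintype κ] [Nonempty κ]
    (h𝒩 : 𝒩.StandingAssumptions)
    (hrun : 𝒩.IsAsyncRun ε D τ y p ζ) (hε : 0 < ε)
    (hG : ∀ y p, (y, p) ∈ 𝒩.constraintSet → ‖𝒩.con y p‖ ≤ G)
    (hGbar : ∀ p ∈ 𝒩.policies, ‖𝒩.conPolicy p‖ ≤ Gbar) :
    ∃ pring : ℕ → 𝒩.Policy,
      (∀ s, 1 ≤ s → (𝒩.runningAverage y s, pring s) ∈ 𝒩.constraintSet) ∧
      Tendsto (fun s => ‖𝒩.proj (𝒩.con (𝒩.runningAverage y s) (pring s))‖) atTop (𝓝 0) := by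
  -- The tolerance 1/s vanishes in the limit; nothing is required at s = 0, where an arbitrary
  -- policy is supplied.
  have hex : ∀ s : ℕ, ∃ r : 𝒩.Policy, 1 ≤ s → r ∈ 𝒩.policies ∧
      ‖𝒩.conPolicy r - ∑ ℓ ∈ Finset.Icc 1 s, (1 / (s : ℝ)) • 𝒩.conPolicy (p (τ ℓ))‖
        < 1 / (s : ℝ) := fun s => by
    by_cases hs : 1 ≤ s
    · have hs' : (0 : ℝ) < s := by exact_mod_cast hs
      obtain ⟨r, hr, hlt⟩ := exists_policy_conPolicy_near h𝒩
        ((convex_convexHull ℝ (𝒩.conPolicy '' 𝒩.policies)).sum_mem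
          (t := Finset.Icc 1 s) (w := fun _ => 1 / (s : ℝ)) (z := fun ℓ => 𝒩.conPolicy (p (τ ℓ)))
          (fun _ _ => by positivity) (sum_weights_eq_one hs)
          fun ℓ hℓ => subset_convexHull ℝ _
            ⟨_, hrun.policy_mem ℓ (Finset.mem_Icc.1 hℓ).1, rfl⟩)
        (one_div_pos.2 hs')
      exact ⟨r, fun _ => ⟨hr, hlt⟩⟩
    · exact ⟨p 0, fun h => absurd h hs⟩
  choose r hr using hex
  refine ⟨r, fun s hs => ⟨hrun.runningAverage_mem_box hs, (hr s hs).1⟩, ?_⟩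
  have hmaj : Tendsto (fun s : ℕ => ε⁻¹ * (‖ζ (s + 1)‖ / s) + 1 / (s : ℝ)) atTop (𝓝 0) := by
    simpa using ((hrun.tendsto_norm_multiplier_div h𝒩 hε hG hGbar).const_mul ε⁻¹).add
      (tendsto_one_div_atTop_nhds_zero_nat (𝕜 := ℝ))
  refine squeeze_zero' (Eventually.of_forall fun s => norm_nonneg _) ?_ hmaj
  filter_upwards [eventually_ge_atTop 1] with s hs
  have hs' : (0 : ℝ) < s := by exact_mod_cast hs
  set d := 𝒩.conPolicy (r s)
    - ∑ ℓ ∈ Finset.Icc 1 s, (1 / (s : ℝ)) • 𝒩.conPolicy (p (τ ℓ)) with hd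
  -- By linearity, the constraint at the average is the average of the constraints plus the
  -- emulation error `d`.
  have hcon : 𝒩.con (𝒩.runningAverage y s) (r s)
      = (ε⁻¹ * (1 / (s : ℝ))) • (ε • ∑ ℓ ∈ Finset.Icc 1 s, 𝒩.con (y ℓ) (p (τ ℓ))) + d := by
    have hlin : 𝒩.conPrimal (𝒩.runningAverage y s)
        = (1 / (s : ℝ)) • ∑ ℓ ∈ Finset.Icc 1 s, 𝒩.conPrimal (y ℓ) := by
      rw [runningAverage, conPrimal_smul]
      exact congrArg _ (map_sum 𝒩.conPrimalLinear _ _)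
    rw [smul_smul, mul_right_comm, inv_mul_cancel₀ hε.ne', one_mul, hd, con, hlin]
    simp only [con, Finset.sum_add_distrib, smul_add, Finset.smul_sum]
    abel
  have hle : ‖𝒩.proj (𝒩.con (𝒩.runningAverage y s) (r s))‖
      ≤ ‖(ε⁻¹ * (1 / (s : ℝ))) • ζ (s + 1) + d‖ := by
    refine 𝒩.norm_proj_le_of_le fun k => ?_
    rw [hcon, PiLp.add_apply, PiLp.add_apply]
    have := mul_le_mul_of_nonneg_left (hrun.sum_con_le_multiplier s k)
      (by positivity : 0 ≤ ε⁻¹ * (1 / (s : ℝ)))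
    exact add_le_add_left this _
  refine hle.trans ((norm_add_le _ _).trans (add_le_add (le_of_eq ?_) (hr s hs).2.le))
  rw [norm_smul, Real.norm_of_nonneg (by positivity)]
  ring

/-- The supremum need not be attained, so the bound is proved against each feasible pair. The finite
constant is moved across the inequality to reach the supremum, then moved back. -/
lemma optimalValue_sub_le_liminf [Fintype κ] (h𝒩 : 𝒩.StandingAssumptions)
    (hrun : 𝒩.IsAsyncRun ε D τ y p ζ) (hε : 0 < ε)
    (hG : ∀ y p, (y, p) ∈ 𝒩.constraintSet → ‖𝒩.con y p‖ ≤ G)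
    (hGbar : ∀ p ∈ 𝒩.policies, ‖𝒩.conPolicy p‖ ≤ Gbar) :
    𝒩.optimalValue - ((ε * G ^ 2 / 2 + 2 * ε * D * Gbar * G : ℝ) : EReal)
      ≤ liminf (fun s => (𝒩.objective (𝒩.runningAverage y s) : EReal)) atTop := by
  rw [EReal.sub_le_iff_le_add (.inl (EReal.coe_ne_bot _)) (.inl (EReal.coe_ne_top _))]
  refine sSup_le ?_
  rintro _ ⟨w, r, hwr, hfeas, rfl⟩
  rw [← EReal.sub_le_iff_le_add (.inl (EReal.coe_ne_bot _)) (.inl (EReal.coe_ne_top _)),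
    ← EReal.coe_sub]
  set c : ℝ := 𝒩.objective w - (ε * G ^ 2 / 2 + 2 * ε * D * Gbar * G) with hc
  have hlim : Tendsto (fun s : ℕ => c - ‖ζ 1‖ ^ 2 / (2 * ε) * (s : ℝ)⁻¹) atTop (𝓝 c) := by
    simpa using
      ((tendsto_inv_atTop_nhds_zero_nat (𝕜 := ℝ)).const_mul (‖ζ 1‖ ^ 2 / (2 * ε))).const_sub c
  have hlim' := (continuous_coe_real_ereal.tendsto c).comp hlim
  rw [← hlim'.liminf_eq]
  refine liminf_le_liminf ?_
  filter_upwards [eventually_ge_atTop 1] with s hs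
  have hs' : (0 : ℝ) < s := by exact_mod_cast hs
  refine EReal.coe_le_coe_iff.2 (le_trans ?_ (hrun.sum_objective_le_runningAverage h𝒩 hs))
  rw [le_div_iff₀ hs']
  refine le_trans ?_ (hrun.sum_objective_ge hε hG hGbar hwr hfeas s)
  rw [← hc, sub_mul, mul_assoc, inv_mul_cancel₀ hs'.ne', sub_div]
  have : 0 ≤ ‖ζ (s + 1)‖ ^ 2 / (2 * ε) := by positivity
  linarith

end IsAsyncRun

end CodedNetwork

theorem proposition5 {N F M κ : Type*} [Fintype N] [DecidableEq N] [Fintype F] [Fintype M]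
    [Fintype κ] [Nonempty κ] (𝒩 : CodedNetwork N F M κ) (h𝒩 : 𝒩.StandingAssumptions)
    (G Gbar : ℝ)
    (hG : ∀ y p, (y, p) ∈ 𝒩.constraintSet → ‖𝒩.con y p‖ ≤ G)
    (hGbar : ∀ p ∈ 𝒩.policies, ‖𝒩.conPolicy p‖ ≤ Gbar)
    (ε : ℝ) (hε : 0 < ε) (D : ℕ) (τ : ℕ → ℕ)
    (y : ℕ → 𝒩.Primal) (p : ℕ → 𝒩.Policy) (ζ : ℕ → 𝒩.Mult)
    (hrun : 𝒩.IsAsyncRun ε D τ y p ζ) :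
    (∃ pring : ℕ → 𝒩.Policy,
      (∀ s, 1 ≤ s → (𝒩.runningAverage y s, pring s) ∈ 𝒩.constraintSet) ∧
      Tendsto (fun s => ‖𝒩.proj (𝒩.con (𝒩.runningAverage y s) (pring s))‖) atTop (𝓝 0)) ∧
    𝒩.optimalValue - ((ε * G ^ 2 / 2 + 2 * ε * D * Gbar * G : ℝ) : EReal)
      ≤ liminf (fun s => (𝒩.objective (𝒩.runningAverage y s) : EReal)) atTop ∧
    limsup (fun s => (𝒩.objective (𝒩.runningAverage y s) : EReal)) atTop
      ≤ 𝒩.optimalValue := by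
  obtain ⟨pring, hmem, hlim⟩ := hrun.exists_policies_asymptotically_feasible h𝒩 hε hG hGbar
  exact ⟨⟨pring, hmem, hlim⟩, hrun.optimalValue_sub_le_liminf h𝒩 hε hG hGbar,
    CodedNetwork.limsup_objective_le_optimalValue h𝒩 ((eventually_ge_atTop 1).mono hmem) hlim⟩
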